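/- For complex $a, b, c$ with $c \notin \{0, -1, -2, \dots\}$ and for $|z| < 1$, let $$F(a,b;c;z) = {}_2F_1(a,b;c;z) = \sum_{n=0}^{\infty} \frac{(a)_n (b)_n}{(c)_n} \frac{z^n}{n!}$$ denote the Gauss hypergeometric function, where $(a)_n = a(a+1)\cdots(a+n-1)$ and $(a)_0 = 1$. Then for every real $\lambda$ with $0 < \lambda < 1$, $$F\Big(\frac14, \frac34; 1; 1-\lambda^2\Big) = \sqrt{\frac{2}{1+\lambda}}\; F\Big(\frac12, \frac12; 1; \frac{1-\lambda}{1+\lambda}\Big)$$ and $$F\Big(\frac14, \frac34; 1; \lambda^2\Big) = \sqrt{\frac{1}{1+\lambda}}\; F\Big(\frac12, \frac12; 1; \frac{2\lambda}{1+\lambda}\Big).$$ -/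

import Mathlib

open MeasureTheory Real Set
open scoped Nat ComplexConjugate

/-! Both identities evaluate the circle mean of `(1 - x cos t) ^ (-1/2)` in two ways. Expanding the
binomial series and integrating termwise gives `₂F₁ (1/4) (3/4) 1 (x ^ 2)`
(`integral_inv_sqrt_one_sub_mul_cos`). The half-angle formula instead gives `₂F₁ (1/2) (1/2) 1` at
`2x/(1+x)`, which is the second identity. For `x = 2k/(1+k²)`, Parseval applied to `(1 - k exp (it))
^ (-1/2)` gives it at `k²`; taking `k² = (1-l)/(1+l)` yields the first. -/

/-- The Taylor coefficients `(1/2)ₙ / n!` of `(1 - x) ^ (-1/2)`. -/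
noncomputable def invSqrtCoeff (n : ℕ) : ℝ :=
  (n ! : ℝ)⁻¹ * (ascPochhammer ℝ n).eval (1 / 2)

@[simp] lemma invSqrtCoeff_zero : invSqrtCoeff 0 = 1 := by simp [invSqrtCoeff]

lemma invSqrtCoeff_succ (n : ℕ) :
    invSqrtCoeff (n + 1) = (2 * n + 1) / (2 * n + 2) * invSqrtCoeff n := by
  simp only [invSqrtCoeff, ascPochhammer_succ_eval, Nat.factorial_succ]
  push_cast
  field_simp
  ring

lemma invSqrtCoeff_nonneg (n : ℕ) : 0 ≤ invSqrtCoeff n := by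
  induction n with
  | zero => simp
  | succ n ih => rw [invSqrtCoeff_succ]; positivity

lemma invSqrtCoeff_le_one (n : ℕ) : invSqrtCoeff n ≤ 1 := by
  induction n with
  | zero => simp
  | succ n ih =>
    rw [invSqrtCoeff_succ]
    refine mul_le_one₀ ?_ (invSqrtCoeff_nonneg n) ih
    rw [div_le_one (by positivity)]
    linarith

lemma ringChoose_add_sub_one_eq {K : Type*} [Field K] [CharZero K] (a : K) (n : ℕ) :
    Ring.choose (a + n - 1) n = (n ! : K)⁻¹ * (ascPochhammer K n).eval a := by
  rw [← Ring.multichoose_eq, eq_inv_mul_iff_mul_eq₀ (by exact_mod_cast n.factorial_ne_zero),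
    ← nsmul_eq_mul, Ring.factorial_nsmul_multichoose_eq_ascPochhammer,
    Polynomial.ascPochhammer_smeval_eq_eval]

lemma ofReal_invSqrtCoeff (n : ℕ) :
    (invSqrtCoeff n : ℂ) = (n ! : ℂ)⁻¹ * (ascPochhammer ℂ n).eval (1 / 2) := by
  induction n with
  | zero => simp
  | succ n ih =>
    rw [invSqrtCoeff_succ, ascPochhammer_succ_eval, Nat.factorial_succ]
    push_cast
    rw [ih]
    have : (n : ℂ) + 1 ≠ 0 := by exact_mod_cast n.succ_ne_zero
    rw [show (2 : ℂ) * n + 2 = 2 * (n + 1) by ring]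
    field_simp
    ring

lemma hasSum_invSqrtCoeff_mul_pow {x : ℝ} (hx : |x| < 1) :
    HasSum (fun n ↦ invSqrtCoeff n * x ^ n) (√(1 - x))⁻¹ := by
  have h := (one_div_one_sub_rpow_hasFPowerSeriesOnBall_zero (1 / 2)).hasSum
    (y := x) (by simpa [enorm_eq_nnnorm, ← NNReal.coe_lt_coe] using hx)
  simpa [ringChoose_add_sub_one_eq, FormalMultilinearSeries.ofScalars_apply_eq, invSqrtCoeff,
    sqrt_eq_rpow, mul_comm] using h

lemma Complex.hasSum_invSqrtCoeff_mul_pow {z : ℂ} (hz : ‖z‖ < 1) :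
    HasSum (fun n ↦ (invSqrtCoeff n : ℂ) * z ^ n) ((1 - z) ^ (1 / 2 : ℂ))⁻¹ := by
  have h := (Complex.one_div_one_sub_cpow_hasFPowerSeriesOnBall_zero (1 / 2)).hasSum
    (y := z) (by simpa [enorm_eq_nnnorm, ← NNReal.coe_lt_coe] using hz)
  simpa [ringChoose_add_sub_one_eq, FormalMultilinearSeries.ofScalars_apply_eq,
    ofReal_invSqrtCoeff, mul_comm] using h

lemma hasSum_intervalIntegral_of_norm_le {ι E : Type*} [Countable ι] [NormedAddCommGroup E]
    [NormedSpace ℝ E] {F : ι → ℝ → E} {f : ℝ → E} {u : ι → ℝ} (a b : ℝ)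
    (hF : ∀ i, Continuous (F i)) (hu : Summable u) (hFu : ∀ i t, ‖F i t‖ ≤ u i)
    (hf : ∀ t, HasSum (F · t) (f t)) :
    HasSum (fun i ↦ ∫ t in a..b, F i t) (∫ t in a..b, f t) :=
  intervalIntegral.hasSum_integral_of_dominated_convergence (fun i _ ↦ u i)
    (fun i ↦ (hF i).aestronglyMeasurable)
    (fun i ↦ .of_forall fun t _ ↦ hFu i t) (.of_forall fun _ _ ↦ hu)
    intervalIntegrable_const (.of_forall fun t _ ↦ hf t)

lemma integral_cos_pow_even (n : ℕ) :
    ∫ t in (0)..(2 * π), cos t ^ (2 * n) = 2 * π * invSqrtCoeff n := by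
  induction n with
  | zero => simp
  | succ n ih =>
    rw [mul_add, mul_one, integral_cos_pow, ih, invSqrtCoeff_succ]
    simp
    ring

lemma integral_cos_pow_odd (n : ℕ) :
    ∫ t in (0)..(2 * π), cos t ^ (2 * n + 1) = 0 := by
  induction n with
  | zero => simp
  | succ n ih =>
    rw [show 2 * (n + 1) + 1 = 2 * n + 1 + 2 by ring, integral_cos_pow, ih]
    simp

lemma integral_sin_pow_even_zero_pi (n : ℕ) :
    ∫ t in (0)..π, sin t ^ (2 * n) = π * invSqrtCoeff n := by
  induction n with
  | zero => simp
  | succ n ih =>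
    rw [mul_add, mul_one, integral_sin_pow, ih, invSqrtCoeff_succ]
    simp
    ring

lemma ordinaryHypergeometric_half_half (x : ℝ) :
    ₂F₁ (1 / 2 : ℝ) (1 / 2 : ℝ) (1 : ℝ) x = ∑' n, invSqrtCoeff n ^ 2 * x ^ n := by
  rw [ordinaryHypergeometric_eq_tsum]
  refine tsum_congr fun n ↦ ?_
  rw [ascPochhammer_eval_one, invSqrtCoeff, smul_eq_mul]
  ring

/-- Both sides have the same consecutive ratios: a factor `2n+1` cancels, leaving
`(4n+1)(4n+3)/(16(n+1)²)`. -/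
lemma invSqrtCoeff_two_mul_mul (n : ℕ) :
    invSqrtCoeff (2 * n) * invSqrtCoeff n =
      (n ! : ℝ)⁻¹ * (ascPochhammer ℝ n).eval (1 / 4) * (ascPochhammer ℝ n).eval (3 / 4) *
        (n ! : ℝ)⁻¹ := by
  induction n with
  | zero => simp
  | succ n ih =>
    have h : invSqrtCoeff (2 * (n + 1)) * invSqrtCoeff (n + 1) =
        (1 / 4 + n) * (3 / 4 + n) / (n + 1) ^ 2 * (invSqrtCoeff (2 * n) * invSqrtCoeff n) := by
      rw [show 2 * (n + 1) = 2 * n + 1 + 1 by ring, invSqrtCoeff_succ, invSqrtCoeff_succ,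
        invSqrtCoeff_succ]
      push_cast
      field_simp
      ring
    rw [h, ih, ascPochhammer_succ_eval, ascPochhammer_succ_eval, Nat.factorial_succ]
    push_cast
    field_simp

lemma ordinaryHypergeometric_quarter_three_quarters (x : ℝ) :
    ₂F₁ (1 / 4 : ℝ) (3 / 4 : ℝ) (1 : ℝ) x =
      ∑' n, invSqrtCoeff (2 * n) * invSqrtCoeff n * x ^ n := by
  rw [ordinaryHypergeometric_eq_tsum]
  refine tsum_congr fun n ↦ ?_
  rw [ascPochhammer_eval_one, invSqrtCoeff_two_mul_mul, smul_eq_mul]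

lemma abs_invSqrtCoeff_mul_pow_le (n : ℕ) {r x c : ℝ} (hr : |x| ≤ r) (hc : |c| ≤ 1) :
    |invSqrtCoeff n * (x * c) ^ n| ≤ r ^ n := by
  rw [abs_mul, abs_pow, abs_mul, abs_of_nonneg (invSqrtCoeff_nonneg n)]
  have h : |x| * |c| ≤ r := (mul_le_of_le_one_right (abs_nonneg x) hc).trans hr
  calc _ ≤ 1 * r ^ n := by
        gcongr
        exact invSqrtCoeff_le_one n
    _ = r ^ n := one_mul _

theorem integral_inv_sqrt_one_sub_mul_cos {x : ℝ} (hx : |x| < 1) :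
    ∫ t in (0)..(2 * π), (√(1 - x * cos t))⁻¹ =
      2 * π * ₂F₁ (1 / 4 : ℝ) (3 / 4 : ℝ) (1 : ℝ) (x ^ 2) := by
  have h := hasSum_intervalIntegral_of_norm_le (F := fun n t ↦ invSqrtCoeff n * (x * cos t) ^ n)
    0 (2 * π) (fun n ↦ by fun_prop) (summable_geometric_of_lt_one (abs_nonneg x) hx)
    (fun n t ↦ abs_invSqrtCoeff_mul_pow_le n le_rfl (abs_cos_le_one t))
    (fun t ↦ hasSum_invSqrtCoeff_mul_pow (by
      rw [abs_mul]
      exact (mul_le_of_le_one_right (abs_nonneg x) (abs_cos_le_one t)).trans_lt hx))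
  simp only [mul_pow, ← mul_assoc, intervalIntegral.integral_const_mul] at h
  -- Only even indices contribute, as odd moments of `cos` vanish.
  rw [← (mul_right_injective₀ (two_ne_zero' ℕ)).hasSum_iff] at h
  · rw [← h.tsum_eq, ordinaryHypergeometric_quarter_three_quarters, ← tsum_mul_left]
    refine tsum_congr fun n ↦ ?_
    rw [Function.comp_apply, integral_cos_pow_even]
    ring
  · intro n hn
    obtain ⟨m, rfl | rfl⟩ := n.even_or_odd'
    · exact absurd ⟨m, rfl⟩ hn
    · rw [integral_cos_pow_odd, mul_zero]

theorem integral_inv_sqrt_one_sub_mul_sin_sq {x : ℝ} (hx : |x| < 1) :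
    ∫ t in (0)..π, (√(1 - x * sin t ^ 2))⁻¹ =
      π * ₂F₁ (1 / 2 : ℝ) (1 / 2 : ℝ) (1 : ℝ) x := by
  have hs (t : ℝ) : |sin t ^ 2| ≤ 1 := by
    rw [abs_of_nonneg (sq_nonneg _)]
    exact sin_sq_le_one t
  have h := hasSum_intervalIntegral_of_norm_le
    (F := fun n t ↦ invSqrtCoeff n * (x * sin t ^ 2) ^ n)
    0 π (fun n ↦ by fun_prop) (summable_geometric_of_lt_one (abs_nonneg x) hx)
    (fun n t ↦ abs_invSqrtCoeff_mul_pow_le n le_rfl (hs t))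
    (fun t ↦ hasSum_invSqrtCoeff_mul_pow (by
      rw [abs_mul]
      exact (mul_le_of_le_one_right (abs_nonneg x) (hs t)).trans_lt hx))
  simp only [mul_pow, ← mul_assoc, ← pow_mul, intervalIntegral.integral_const_mul,
    integral_sin_pow_even_zero_pi] at h
  rw [← h.tsum_eq, ordinaryHypergeometric_half_half, ← tsum_mul_left]
  exact tsum_congr fun n ↦ by ring

lemma integral_exp_int_mul_I (m : ℤ) :
    ∫ t in (0)..(2 * π), Complex.exp (m * Complex.I * t) = if m = 0 then 2 * π else 0 := by
  split_ifs with hm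
  · simp [hm]
  · rw [integral_exp_mul_complex (by simpa using hm)]
    have : Complex.exp (m * Complex.I * ↑(2 * π)) = 1 := by
      rw [Complex.exp_eq_one_iff]
      exact ⟨m, by push_cast; ring⟩
    rw [this]
    simp

/-- Parseval's identity for an absolutely convergent series `∑ aₙ exp (int)`. -/
theorem hasSum_two_pi_mul_norm_sq {a : ℕ → ℂ} {f : ℝ → ℂ} (ha : Summable fun n ↦ ‖a n‖)
    (hf : ∀ t : ℝ, HasSum (fun n : ℕ ↦ a n * Complex.exp (n * Complex.I * t)) (f t)) :
    HasSum (fun n ↦ 2 * π * ‖a n‖ ^ 2) (∫ t in (0)..(2 * π), ‖f t‖ ^ 2) := by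
  let F (n : ℕ) (t : ℝ) : ℂ := a n * Complex.exp (n * Complex.I * t)
  have hF (n : ℕ) (t : ℝ) : ‖F n t‖ = ‖a n‖ := by
    have : (n : ℂ) * Complex.I * t = ((n * t : ℝ) : ℂ) * Complex.I := by push_cast; ring
    rw [norm_mul, this, Complex.norm_exp_ofReal_mul_I, mul_one]
  have hFc (n : ℕ) : Continuous (F n) := by fun_prop
  have hsum (t : ℝ) : Summable fun n ↦ ‖F n t‖ := by simpa only [hF] using ha
  have hprod (t : ℝ) :
      HasSum (fun p : ℕ × ℕ ↦ F p.1 t * conj (F p.2 t)) (f t * conj (f t)) := by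
    have hc : HasSum (fun n ↦ conj (F n t)) (conj (f t)) :=
      (hf t).map (starRingEnd ℂ) Complex.continuous_conj
    have hcn : Summable fun n ↦ ‖conj (F n t)‖ := by simpa only [RCLike.norm_conj] using hsum t
    have hs : Summable fun p : ℕ × ℕ ↦ F p.1 t * conj (F p.2 t) :=
      summable_mul_of_summable_norm (f := (F · t)) (g := fun n ↦ conj (F n t)) (hsum t) hcn
    exact HasSum.mul (f := (F · t)) (g := fun n ↦ conj (F n t)) (hf t) hc hs
  have hbound (p : ℕ × ℕ) (t : ℝ) : ‖F p.1 t * conj (F p.2 t)‖ ≤ ‖a p.1‖ * ‖a p.2‖ := by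
    rw [norm_mul, RCLike.norm_conj, hF, hF]
  have h := hasSum_intervalIntegral_of_norm_le
    (F := fun (p : ℕ × ℕ) t ↦ F p.1 t * conj (F p.2 t)) 0 (2 * π)
    (fun p ↦ (hFc p.1).mul (Complex.continuous_conj.comp (hFc p.2)))
    (Summable.mul_of_nonneg (f := fun n ↦ ‖a n‖) (g := fun n ↦ ‖a n‖) ha ha (fun n ↦ norm_nonneg _) (fun n ↦ norm_nonneg _)) hbound hprod
  have hint (p : ℕ × ℕ) : (∫ t in (0)..(2 * π), F p.1 t * conj (F p.2 t)) =
      a p.1 * conj (a p.2) * ↑(if (p.1 : ℤ) - p.2 = 0 then 2 * π else 0) := by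
    rw [← integral_exp_int_mul_I, ← intervalIntegral.integral_const_mul]
    congr 1 with t
    simp only [F, map_mul, Complex.conj_ofReal, ← Complex.exp_conj, Complex.conj_I, map_natCast]
    rw [show ((((p.1 : ℤ) - p.2 : ℤ) : ℂ) * Complex.I * t) =
      p.1 * Complex.I * t + p.2 * -Complex.I * t by push_cast; ring, Complex.exp_add]
    ring
  have hdiag : Function.Injective fun n : ℕ ↦ (n, n) := fun m n h ↦ congrArg Prod.fst h
  simp only [hint] at h
  -- By orthogonality the double series reduces to its diagonal.
  rw [← hdiag.hasSum_iff] at h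
  · rw [← Complex.hasSum_ofReal, ← intervalIntegral.integral_ofReal]
    convert! h using 2 with n
    · simp [Complex.mul_conj']
      ring
    · simp [Complex.mul_conj']
  · rintro ⟨m, n⟩ hmn
    rw [if_neg, Complex.ofReal_zero, mul_zero]
    intro h0
    exact hmn ⟨m, Prod.ext rfl (by simpa [sub_eq_zero] using h0)⟩

lemma norm_inv_cpow_half_sq {z : ℂ} (hz : z ≠ 0) : ‖(z ^ (1 / 2 : ℂ))⁻¹‖ ^ 2 = ‖z‖⁻¹ := by
  have h : ‖z ^ (1 / 2 : ℂ)‖ = √‖z‖ := by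
    rw [Complex.norm_cpow_of_ne_zero hz]
    simp [sqrt_eq_rpow]
  rw [norm_inv, inv_pow, h, sq_sqrt (norm_nonneg z)]

lemma norm_one_sub_mul_exp_mul_I (k t : ℝ) :
    ‖1 - k * Complex.exp (Complex.I * t)‖ = √(1 + k ^ 2 - 2 * k * cos t) := by
  rw [Complex.norm_def, Complex.normSq_apply, mul_comm Complex.I, Complex.exp_mul_I,
    ← Complex.ofReal_cos, ← Complex.ofReal_sin]
  congr 1
  simp [-Complex.ofReal_cos, -Complex.ofReal_sin]
  linear_combination k ^ 2 * sin_sq_add_cos_sq t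

/-- The integrand is `‖(1 - k exp (it)) ^ (-1/2)‖²`, so Parseval sums the squared coefficients. -/
theorem integral_inv_sqrt_one_add_sq_sub_two_mul_cos {k : ℝ} (hk₀ : 0 ≤ k) (hk : k < 1) :
    ∫ t in (0)..(2 * π), (√(1 + k ^ 2 - 2 * k * cos t))⁻¹ =
      2 * π * ₂F₁ (1 / 2 : ℝ) (1 / 2 : ℝ) (1 : ℝ) (k ^ 2) := by
  let z (t : ℝ) : ℂ := k * Complex.exp (Complex.I * t)
  have hz (t : ℝ) : ‖z t‖ < 1 := by
    simpa [z, mul_comm Complex.I, Complex.norm_exp_ofReal_mul_I, abs_of_nonneg hk₀]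
  have hz1 (t : ℝ) : 1 - z t ≠ 0 := by
    intro h
    have := hz t
    rw [← sub_eq_zero.mp h, norm_one] at this
    exact this.false
  have hnorm (n : ℕ) : ‖(invSqrtCoeff n : ℂ) * (k : ℂ) ^ n‖ = invSqrtCoeff n * k ^ n := by
    rw [norm_mul, norm_pow, Complex.norm_real, Complex.norm_real,
      norm_of_nonneg (invSqrtCoeff_nonneg n), norm_of_nonneg hk₀]
  have ha : Summable fun n ↦ ‖(invSqrtCoeff n : ℂ) * (k : ℂ) ^ n‖ := by
    simp only [hnorm]
    exact (hasSum_invSqrtCoeff_mul_pow (by rwa [abs_of_nonneg hk₀])).summable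
  have h := hasSum_two_pi_mul_norm_sq ha (f := fun t ↦ ((1 - z t) ^ (1 / 2 : ℂ))⁻¹) (fun t ↦ by
    convert! Complex.hasSum_invSqrtCoeff_mul_pow (hz t) using 2 with n
    rw [mul_pow, ← Complex.exp_nat_mul, ← mul_assoc (n : ℂ), mul_assoc])
  simp only [norm_inv_cpow_half_sq (hz1 _), z, norm_one_sub_mul_exp_mul_I, hnorm] at h
  rw [← h.tsum_eq, ordinaryHypergeometric_half_half, ← tsum_mul_left]
  exact tsum_congr fun n ↦ by ring

/-- A quadratic transformation, obtained from `1 + x cos t = (1 + x) (1 - m sin² (t / 2))`. -/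
theorem ordinaryHypergeometric_quarter_three_quarters_sq {x : ℝ} (hx₀ : 0 ≤ x) (hx : x < 1) :
    ₂F₁ (1 / 4 : ℝ) (3 / 4 : ℝ) (1 : ℝ) (x ^ 2) =
      √(1 / (1 + x)) * ₂F₁ (1 / 2 : ℝ) (1 / 2 : ℝ) (1 : ℝ) (2 * x / (1 + x)) := by
  have hx' : 0 < 1 + x := by linarith
  have hm : |2 * x / (1 + x)| < 1 := by
    rw [abs_of_nonneg (by positivity), div_lt_one hx']
    linarith
  -- The sign flip leaves `x ^ 2` unchanged and makes the half-angle form `1 - m sin²` with `m ≥ 0`.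
  have h1 := integral_inv_sqrt_one_sub_mul_cos (x := -x) (by rwa [abs_neg, abs_of_nonneg hx₀])
  have h2 : ∫ t in (0)..(2 * π), (√(1 - -x * cos t))⁻¹ =
      ∫ t in (0)..(2 * π),
        √(1 / (1 + x)) * (√(1 - 2 * x / (1 + x) * sin (t / 2) ^ 2))⁻¹ := by
    congr 1 with t
    have : 1 - -x * cos t = (1 + x) * (1 - 2 * x / (1 + x) * sin (t / 2) ^ 2) := by
      have hc : cos t = 1 - 2 * sin (t / 2) ^ 2 := by
        rw [sin_sq, ← mul_div_cancel₀ t two_ne_zero, mul_div_assoc, cos_two_mul]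
        ring_nf
      rw [hc]
      field_simp
      ring
    rw [this, sqrt_mul hx'.le, mul_inv, one_div, sqrt_inv]
  -- Substituting `s = t / 2` turns `[0, 2π]` into `[0, π]`.
  rw [h2, intervalIntegral.integral_const_mul,
    intervalIntegral.integral_comp_div
      (fun s ↦ (√(1 - 2 * x / (1 + x) * sin s ^ 2))⁻¹) two_ne_zero, zero_div,
    mul_div_cancel_left₀ _ two_ne_zero, integral_inv_sqrt_one_sub_mul_sin_sq hm, neg_sq,
    smul_eq_mul] at h1
  refine mul_left_cancel₀ two_pi_pos.ne' (h1.symm.trans ?_)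
  ring

/-- A quadratic transformation, obtained from `|1 - k exp (it)|² = 1 + k² - 2 k cos t`. -/
theorem ordinaryHypergeometric_quarter_three_quarters_two_mul_div {k : ℝ} (hk₀ : 0 ≤ k)
    (hk : k < 1) :
    ₂F₁ (1 / 4 : ℝ) (3 / 4 : ℝ) (1 : ℝ) ((2 * k / (1 + k ^ 2)) ^ 2) =
      √(1 + k ^ 2) * ₂F₁ (1 / 2 : ℝ) (1 / 2 : ℝ) (1 : ℝ) (k ^ 2) := by
  have hk2 : 0 < 1 + k ^ 2 := by positivity
  have hm : |2 * k / (1 + k ^ 2)| < 1 := by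
    rw [abs_of_nonneg (by positivity), div_lt_one hk2]
    nlinarith [mul_pos (sub_pos.mpr hk) (sub_pos.mpr hk)]
  have h : ∫ t in (0)..(2 * π), (√(1 - 2 * k / (1 + k ^ 2) * cos t))⁻¹ =
      ∫ t in (0)..(2 * π), √(1 + k ^ 2) * (√(1 + k ^ 2 - 2 * k * cos t))⁻¹ := by
    congr 1 with t
    have : 1 + k ^ 2 - 2 * k * cos t = (1 + k ^ 2) * (1 - 2 * k / (1 + k ^ 2) * cos t) := by
      field_simp
    rw [this, sqrt_mul hk2.le, mul_inv, mul_inv_cancel_left₀ (sqrt_pos.mpr hk2).ne']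
  rw [integral_inv_sqrt_one_sub_mul_cos hm, intervalIntegral.integral_const_mul,
    integral_inv_sqrt_one_add_sq_sub_two_mul_cos hk₀ hk] at h
  refine mul_left_cancel₀ two_pi_pos.ne' (h.trans ?_)
  ring

theorem mainTheorem3 (l : ℝ) (hl : l ∈ Set.Ioo (0 : ℝ) 1) :
    ₂F₁ (1 / 4 : ℝ) (3 / 4 : ℝ) (1 : ℝ) (1 - l ^ 2) =
        √(2 / (1 + l)) * ₂F₁ (1 / 2 : ℝ) (1 / 2 : ℝ) (1 : ℝ) ((1 - l) / (1 + l)) ∧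
      ₂F₁ (1 / 4 : ℝ) (3 / 4 : ℝ) (1 : ℝ) (l ^ 2) =
        √(1 / (1 + l)) * ₂F₁ (1 / 2 : ℝ) (1 / 2 : ℝ) (1 : ℝ) (2 * l / (1 + l)) := by
  obtain ⟨hl₀, hl₁⟩ := hl
  refine ⟨?_, ordinaryHypergeometric_quarter_three_quarters_sq hl₀.le hl₁⟩
  have h0 : 0 ≤ (1 - l) / (1 + l) := div_nonneg (by linarith) (by linarith)
  have h1 : √((1 - l) / (1 + l)) < 1 := by
    rw [sqrt_lt' one_pos, one_pow, div_lt_one (by linarith)]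
    linarith
  -- With `k² = (1-l)/(1+l)`, `1 + k² = 2/(1+l)` and `(2k/(1+k²))² = 1 - l²`.
  have h := ordinaryHypergeometric_quarter_three_quarters_two_mul_div (sqrt_nonneg _) h1
  have e1 : 1 + (1 - l) / (1 + l) = 2 / (1 + l) := by field_simp; ring
  rw [div_pow, mul_pow, sq_sqrt h0, e1] at h
  convert h using 2
  field_simp
  ring
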